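/- Let $0<a\le \tfrac12$. For $r\in(0,1)$ put $r'=\sqrt{1-r^2}$ and let $$\mu_a(r)=\frac{\pi}{2\sin(\pi a)}\,\frac{F(a,1-a;1;r'^2)}{F(a,1-a;1;r^2)},$$ where $F$ is the Gaussian hypergeometric function ${}_2F_1$; $\mu_a$ is a bijection from $(0,1)$ onto $(0,\infty)$. For $K>0$ let $\varphi_K(a,r)=\mu_a^{-1}\!\left(\mu_a(r)/K\right)$ be the generalized Hersch–Pfluger distortion function. Then for every $K>1$ the function $$f_K(r)=\varphi_K(a,r)\,r^{-1/K}$$ is strictly decreasing on $(0,1)$. -/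

import Mathlib

noncomputable section

/-- The complementary argument `r' = √(1 - r²)`. -/
def complArg (r : ℝ) : ℝ := Real.sqrt (1 - r ^ 2)

/-- The generalized Grötzsch modulus
`μ_a(r) = π / (2 sin (π a)) * F(a, 1 - a; 1; r'²) / F(a, 1 - a; 1; r²)`,
where `F` is the Gaussian hypergeometric function; used for `0 < r < 1`, where both arguments
of `F` lie in `(0, 1)`. -/
def genModulus (a r : ℝ) : ℝ :=
  Real.pi / (2 * Real.sin (Real.pi * a)) *
    (ordinaryHypergeometric a (1 - a) (1 : ℝ) (complArg r ^ 2) /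
      ordinaryHypergeometric a (1 - a) (1 : ℝ) (r ^ 2))

/-- The generalized Hersch–Pfluger distortion function `φ_K(a, r) = μ_a⁻¹(μ_a(r) / K)`, where
`μ_a⁻¹` is the inverse of `μ_a` on the interval `(0, 1)`. -/
def genHerschPfluger (K a r : ℝ) : ℝ :=
  Function.invFunOn (genModulus a) (Set.Ioo 0 1) (genModulus a r / K)

/-- The function `f_K(r) = φ_K(a, r) * r ^ (-1/K)`. -/
def normalizedDistortion (K a r : ℝ) : ℝ :=
  genHerschPfluger K a r * r ^ (-(1 / K))

end

open Set Filter Topology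

/-! With M(t) = μ_a(eᵗ) for t < 0, u = log r and v = log φ_K(a, r), the definition reads M(v) =
M(u)/K, and the claim is that v - u/K strictly decreases in u.

This follows once M is strictly decreasing and strictly concave. Then v > u, and for u₁ < u₂ the
chord of M over [v₁, v₂] is steeper downwards than the one over [u₁, u₂]; as its drop is K times
smaller, v₂ - v₁ < (u₂ - u₁)/K.

Write F for `hypF a`, G for `hypMean a`. The relations (1 - x) F' = a(1 - a) G and (x G)' = F yield
a Legendre relation, whence M'(t) = -C / ((1 - x) F(x)²) with x = e²ᵗ and C > 0. Concavity thus
reduces to the decrease of (1 - x) F². -/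

/-- The coefficients of `₂F₁(a, 1 - a; 1; x)`. -/
noncomputable abbrev hypCoeff (a : ℝ) (n : ℕ) : ℝ := ordinaryHypergeometricCoefficient a (1 - a) 1 n

/-- The companion series `∑ cₙ xⁿ / (n + 1)` of `₂F₁(a, 1 - a; 1; x) = ∑ cₙ xⁿ`. -/
noncomputable def hypMean (a x : ℝ) : ℝ := ∑' n : ℕ, hypCoeff a n / (n + 1) * x ^ n

/-- `₂F₁(a, 1 - a; 1; x)`. -/
noncomputable abbrev hypF (a x : ℝ) : ℝ := ordinaryHypergeometric a (1 - a) (1 : ℝ) x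

lemma hypF_eq_tsum (a x : ℝ) : hypF a x = ∑' n : ℕ, hypCoeff a n * x ^ n := by
  simp only [hypF, ordinaryHypergeometric_eq_tsum, smul_eq_mul, hypCoeff]

lemma hypCoeff_zero (a : ℝ) : hypCoeff a 0 = 1 := by
  simp [hypCoeff, ordinaryHypergeometricCoefficient]

lemma hypCoeff_succ (a : ℝ) (n : ℕ) :
    hypCoeff a (n + 1) = hypCoeff a n * ((a + n) * (1 - a + n)) / (n + 1) ^ 2 := by
  have h2 : ((n.factorial : ℕ) : ℝ) ≠ 0 := by positivity
  have h3 : (n : ℝ) + 1 ≠ 0 := by positivity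
  simp only [hypCoeff, ordinaryHypergeometricCoefficient, ascPochhammer_succ_eval,
    ascPochhammer_eval_one, Nat.factorial_succ, Nat.cast_mul, Nat.cast_add, Nat.cast_one]
  field_simp
  ring

lemma succ_mul_hypCoeff_succ (a : ℝ) (n : ℕ) :
    (n + 1) * hypCoeff a (n + 1) = n * hypCoeff a n + a * (1 - a) * (hypCoeff a n / (n + 1)) := by
  have h3 : (n : ℝ) + 1 ≠ 0 := by positivity
  rw [hypCoeff_succ]
  field_simp
  ring

/-! ### Termwise differentiation of power series with bounded coefficients. -/

section PowerSeries

variable {d : ℕ → ℝ} {x : ℝ}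

lemma summable_mul_pow_of_abs_le_one (hd : ∀ n, |d n| ≤ 1) (hx : |x| < 1) :
    Summable fun n => d n * x ^ n := by
  refine Summable.of_norm_bounded (summable_geometric_of_lt_one (abs_nonneg x) hx) fun n => ?_
  rw [Real.norm_eq_abs, abs_mul, abs_pow]
  exact mul_le_of_le_one_left (by positivity) (hd n)

lemma summable_mul_nat_mul_pow_of_abs_le_one (hd : ∀ n, |d n| ≤ 1) (hx : |x| < 1) :
    Summable fun n : ℕ => d n * (n * x ^ n) := by
  have h := summable_pow_mul_geometric_of_norm_lt_one 1 (r := |x|) (by simpa using hx)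
  refine Summable.of_norm_bounded h fun n => ?_
  rw [Real.norm_eq_abs, abs_mul, abs_mul, abs_pow, Nat.abs_cast, pow_one]
  exact mul_le_of_le_one_left (by positivity) (hd n)

lemma summable_mul_nat_mul_pow_pred_of_abs_le_one (hd : ∀ n, |d n| ≤ 1) (hx : |x| < 1) :
    Summable fun n : ℕ => d n * (n * x ^ (n - 1)) := by
  rw [← summable_nat_add_iff 1]
  have h := (summable_mul_nat_mul_pow_of_abs_le_one (d := fun n => d (n + 1))
    (fun n => hd _) hx).add (summable_mul_pow_of_abs_le_one (fun n => hd (n + 1)) hx)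
  refine h.congr fun n => ?_
  push_cast
  ring

lemma hasDerivAt_tsum_mul_pow_of_abs_le_one (hd : ∀ n, |d n| ≤ 1) (hx : |x| < 1) :
    HasDerivAt (fun z => ∑' n, d n * z ^ n) (∑' n : ℕ, d n * (n * x ^ (n - 1))) x := by
  -- On the ball of radius ρ the differentiated terms are dominated by n ρⁿ⁻¹, which is summable.
  obtain ⟨ρ, hxρ, hρ⟩ := exists_between hx
  have hρ0 : 0 ≤ ρ := (abs_nonneg x).trans hxρ.le
  have hu := summable_mul_nat_mul_pow_pred_of_abs_le_one (d := fun _ => 1) (x := ρ) (by simp)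
    (by rwa [abs_of_nonneg hρ0])
  refine hasDerivAt_tsum_of_isPreconnected (t := Metric.ball (0 : ℝ) ρ) (y₀ := x) hu
    Metric.isOpen_ball (convex_ball _ _).isPreconnected
    (fun n y _ => (hasDerivAt_pow n y).const_mul (d n)) (fun n y hy => ?_)
    (by simpa using hxρ) (summable_mul_pow_of_abs_le_one hd hx) (by simpa using hxρ)
  have hy' : |y| ≤ ρ := by simpa using (mem_ball_zero_iff.1 hy).le
  rw [Real.norm_eq_abs, abs_mul, abs_mul, abs_pow, Nat.abs_cast]
  gcongr
  exact hd n

end PowerSeries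

/-! ### The hypergeometric series: coefficients, differential relations, behaviour at 1. -/

section Parameters

variable {a : ℝ} {x : ℝ}

lemma hypCoeff_pos (ha : a ∈ Ioo (0 : ℝ) 1) (n : ℕ) : 0 < hypCoeff a n := by
  induction n with
  | zero => simp [hypCoeff_zero]
  | succ n ih =>
    have h1 := ha.1
    have h2 : 0 < 1 - a := sub_pos.2 ha.2
    rw [hypCoeff_succ]
    positivity

lemma hypCoeff_le_one (ha : a ∈ Ioo (0 : ℝ) 1) (n : ℕ) : hypCoeff a n ≤ 1 := by
  induction n with
  | zero => simp [hypCoeff_zero]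
  | succ n ih =>
    have h1 := ha.1
    have h2 := ha.2
    have h3 := hypCoeff_pos ha n
    rw [hypCoeff_succ, div_le_one (by positivity)]
    have h4 : (a + n) * (1 - a + n) ≤ (n + 1) ^ 2 := by
      nlinarith [(n.cast_nonneg : (0 : ℝ) ≤ n), mul_pos h1 (sub_pos.2 h2)]
    have h5 : 0 ≤ (a + n) * (1 - a + n) := by
      have : 0 < 1 - a := sub_pos.2 h2
      positivity
    nlinarith

lemma abs_hypCoeff_le_one (ha : a ∈ Ioo (0 : ℝ) 1) (n : ℕ) : |hypCoeff a n| ≤ 1 := by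
  rw [abs_of_pos (hypCoeff_pos ha n)]
  exact hypCoeff_le_one ha n

lemma hypCoeff_div_le (ha : a ∈ Ioo (0 : ℝ) 1) (n : ℕ) :
    hypCoeff a n / (n + 1) ≤ hypCoeff a n :=
  div_le_self (hypCoeff_pos ha n).le (by simp)

lemma abs_hypCoeff_div_le_one (ha : a ∈ Ioo (0 : ℝ) 1) (n : ℕ) :
    |hypCoeff a n / (n + 1)| ≤ 1 := by
  have := hypCoeff_pos ha n
  rw [abs_of_pos (by positivity)]
  exact (hypCoeff_div_le ha n).trans (hypCoeff_le_one ha n)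

/-- By the recurrence, n cₙ is nondecreasing in n, and it equals a(1 - a) at n = 1. This feeds the
logarithmic lower bound that makes F blow up at 1. -/
lemma mul_one_sub_le_hypCoeff (ha : a ∈ Ioo (0 : ℝ) 1) (n : ℕ) :
    a * (1 - a) ≤ (n + 1) * hypCoeff a (n + 1) := by
  have h1 := ha.1
  have h2 : 0 < 1 - a := sub_pos.2 ha.2
  induction n with
  | zero => simp [hypCoeff_succ, hypCoeff_zero]
  | succ n ih =>
    rw [succ_mul_hypCoeff_succ]
    have := hypCoeff_pos ha (n + 1)
    push_cast at ih ⊢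
    have h3 : 0 ≤ a * (1 - a) * (hypCoeff a (n + 1) / (n + 1 + 1)) := by positivity
    linarith

lemma one_sub_mul_tsum_deriv_hypF (ha : a ∈ Ioo (0 : ℝ) 1) (hx : |x| < 1) :
    (1 - x) * ∑' n : ℕ, hypCoeff a n * (n * x ^ (n - 1)) = a * (1 - a) * hypMean a x := by
  have hc := abs_hypCoeff_le_one ha
  have h1 := summable_mul_nat_mul_pow_pred_of_abs_le_one hc hx
  have h2 := summable_mul_nat_mul_pow_of_abs_le_one hc hx
  have h3 : x * ∑' n : ℕ, hypCoeff a n * (n * x ^ (n - 1)) =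
      ∑' n : ℕ, hypCoeff a n * (n * x ^ n) := by
    rw [← tsum_mul_left]
    refine tsum_congr fun n => ?_
    rcases n with _ | n
    · simp
    · simp only [Nat.add_sub_cancel]
      ring
  have h4 : ∑' n : ℕ, hypCoeff a n * (n * x ^ (n - 1)) =
      ∑' n : ℕ, (hypCoeff a n * (n * x ^ n) +
        a * (1 - a) * (hypCoeff a n / (n + 1) * x ^ n)) := by
    rw [h1.tsum_eq_zero_add]
    simp only [Nat.cast_zero, zero_mul, mul_zero, zero_add]
    refine tsum_congr fun n => ?_
    have := succ_mul_hypCoeff_succ a n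
    simp only [Nat.add_sub_cancel]
    push_cast
    linear_combination x ^ n * this
  rw [sub_mul, one_mul, h3, h4, Summable.tsum_add h2
    ((summable_mul_pow_of_abs_le_one (abs_hypCoeff_div_le_one ha) hx).mul_left _), tsum_mul_left,
    hypMean]
  ring

lemma hasDerivAt_hypF (ha : a ∈ Ioo (0 : ℝ) 1) (hx : |x| < 1) :
    HasDerivAt (hypF a) (a * (1 - a) * hypMean a x / (1 - x)) x := by
  have h : 1 - x ≠ 0 := (sub_pos.2 (abs_lt.1 hx).2).ne'
  rw [← one_sub_mul_tsum_deriv_hypF ha hx, mul_div_cancel_left₀ _ h]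
  have := hasDerivAt_tsum_mul_pow_of_abs_le_one (abs_hypCoeff_le_one ha) hx
  rwa [← funext (hypF_eq_tsum a)] at this

lemma hasDerivAt_mul_hypMean (ha : a ∈ Ioo (0 : ℝ) 1) (hx : |x| < 1) :
    HasDerivAt (fun z => z * hypMean a z) (hypF a x) x := by
  have hc := abs_hypCoeff_div_le_one ha
  have h := (hasDerivAt_id x).mul (hasDerivAt_tsum_mul_pow_of_abs_le_one hc hx)
  refine h.congr_deriv ?_
  rw [id, one_mul, ← tsum_mul_left, ← Summable.tsum_add (summable_mul_pow_of_abs_le_one hc hx)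
    ((summable_mul_nat_mul_pow_pred_of_abs_le_one hc hx).mul_left x), hypF_eq_tsum]
  refine tsum_congr fun n => ?_
  have h3 : (n : ℝ) + 1 ≠ 0 := by positivity
  rcases n with _ | n
  · simp
  · simp only [Nat.add_sub_cancel]
    field_simp
    ring

lemma hypMean_le_hypF (ha : a ∈ Ioo (0 : ℝ) 1) (hx : x ∈ Ico (0 : ℝ) 1) :
    hypMean a x ≤ hypF a x := by
  have hx' : |x| < 1 := by rw [abs_of_nonneg hx.1]; exact hx.2
  rw [hypF_eq_tsum]
  exact Summable.tsum_le_tsum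
    (fun n => mul_le_mul_of_nonneg_right (hypCoeff_div_le ha n) (pow_nonneg hx.1 n))
    (summable_mul_pow_of_abs_le_one (abs_hypCoeff_div_le_one ha) hx')
    (summable_mul_pow_of_abs_le_one (abs_hypCoeff_le_one ha) hx')

lemma hypMean_pos (ha : a ∈ Ioo (0 : ℝ) 1) (hx : x ∈ Ico (0 : ℝ) 1) : 0 < hypMean a x := by
  have hx' : |x| < 1 := by rw [abs_of_nonneg hx.1]; exact hx.2
  refine (summable_mul_pow_of_abs_le_one (abs_hypCoeff_div_le_one ha) hx').tsum_pos
    (fun n => ?_) 0 (by simp [hypCoeff_zero])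
  have := hypCoeff_pos ha n
  have := hx.1
  positivity

lemma hypF_pos (ha : a ∈ Ioo (0 : ℝ) 1) (hx : x ∈ Ico (0 : ℝ) 1) : 0 < hypF a x :=
  (hypMean_pos ha hx).trans_le (hypMean_le_hypF ha hx)

lemma neg_log_le_hypF (ha : a ∈ Ioo (0 : ℝ) 1) (hx : x ∈ Ico (0 : ℝ) 1) :
    a * (1 - a) * -Real.log (1 - x) ≤ hypF a x := by
  have hx' : |x| < 1 := by rw [abs_of_nonneg hx.1]; exact hx.2
  have hs := summable_mul_pow_of_abs_le_one (abs_hypCoeff_le_one ha) hx'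
  have hl := (Real.hasSum_pow_div_log_of_abs_lt_one hx').mul_left (a * (1 - a))
  rw [hypF_eq_tsum, ← hl.tsum_eq, hs.tsum_eq_zero_add]
  refine (Summable.tsum_le_tsum (fun n => ?_) hl.summable ((summable_nat_add_iff 1).2 hs)).trans
    (le_add_of_nonneg_left (by simp [hypCoeff_zero]))
  have h := mul_one_sub_le_hypCoeff ha n
  have h1 : 0 ≤ x ^ (n + 1) / ((n : ℝ) + 1) := by have := hx.1; positivity
  calc _ ≤ ((n : ℝ) + 1) * hypCoeff a (n + 1) * (x ^ (n + 1) / ((n : ℝ) + 1)) := by gcongr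
    _ = _ := by field_simp

lemma tendsto_hypF_atTop (ha : a ∈ Ioo (0 : ℝ) 1) : Tendsto (hypF a) (𝓝[<] 1) atTop := by
  have hq : 0 < a * (1 - a) := mul_pos ha.1 (sub_pos.2 ha.2)
  have h1 : Tendsto (fun x : ℝ => 1 - x) (𝓝[<] 1) (𝓝[>] 0) := by
    refine tendsto_nhdsWithin_iff.2 ⟨?_, ?_⟩
    · have : Tendsto (fun x : ℝ => 1 - x) (𝓝 1) (𝓝 (1 - 1)) := by
        exact tendsto_const_nhds.sub tendsto_id
      rw [sub_self] at this
      exact this.mono_left nhdsWithin_le_nhds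
    · filter_upwards [self_mem_nhdsWithin] with x hx
      exact sub_pos.2 (mem_Iio.1 hx)
  have h2 : Tendsto (fun x : ℝ => a * (1 - a) * -Real.log (1 - x)) (𝓝[<] 1) atTop :=
    (tendsto_neg_atBot_atTop.comp (Real.tendsto_log_nhdsGT_zero.comp h1)).const_mul_atTop hq
  refine tendsto_atTop_mono' _ ?_ h2
  filter_upwards [Ioo_mem_nhdsLT (zero_lt_one' ℝ)] with x hx
  exact neg_log_le_hypF ha ⟨hx.1.le, hx.2⟩

/-- Legendre's relation in a weak form: the Wronskian expression is a constant. -/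
lemma exists_legendre_const (ha : a ∈ Ioo (0 : ℝ) 1) : ∃ w : ℝ, 0 < w ∧ ∀ x ∈ Ioo (0 : ℝ) 1,
    x * hypMean a x * hypF a (1 - x) + hypF a x * ((1 - x) * hypMean a (1 - x)) = w := by
  set W : ℝ → ℝ := fun x =>
    x * hypMean a x * hypF a (1 - x) + hypF a x * ((1 - x) * hypMean a (1 - x)) with hW
  have hder : ∀ x ∈ Ioo (0 : ℝ) 1, HasDerivAt W 0 x := by
    intro x hx
    have hx1 : |x| < 1 := by rw [abs_of_pos hx.1]; exact hx.2
    have hx2 : |1 - x| < 1 := by rw [abs_of_pos (sub_pos.2 hx.2)]; linarith [hx.1]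
    have hs : HasDerivAt (fun y : ℝ => 1 - y) (-1) x := by
      simpa using (hasDerivAt_id x).const_sub 1
    have h := ((hasDerivAt_mul_hypMean ha hx1).mul
      ((hasDerivAt_hypF ha hx2).comp x hs)).add ((hasDerivAt_hypF ha hx1).mul
      ((hasDerivAt_mul_hypMean ha hx2).comp x hs))
    -- The product rule gives F(x) F(1 - x) and a(1 - a) G(x) G(1 - x), each once with either sign.
    refine h.congr_deriv ?_
    have h0 := hx.1.ne'
    have h1 : 1 - x ≠ 0 := (sub_pos.2 hx.2).ne'
    have h2 : 1 - (1 - x) ≠ 0 := by rwa [sub_sub_cancel]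
    simp only [Function.comp_apply, sub_sub_cancel]
    field_simp
    ring
  have hhalf : (1 / 2 : ℝ) ∈ Ioo (0 : ℝ) 1 := by norm_num
  refine ⟨W (1 / 2), ?_, fun x hx => ?_⟩
  · have h1 : (1 / 2 : ℝ) ∈ Ico (0 : ℝ) 1 := by norm_num
    have h2 : (1 - 1 / 2 : ℝ) ∈ Ico (0 : ℝ) 1 := by norm_num
    have := hypMean_pos ha h1
    have := hypMean_pos ha h2
    have := hypF_pos ha h1
    have := hypF_pos ha h2
    have h3 : (0 : ℝ) < 1 - 1 / 2 := by norm_num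
    simp only [hW]
    positivity
  · exact isOpen_Ioo.is_const_of_deriv_eq_zero isPreconnected_Ioo
      (fun y hy => (hder y hy).differentiableAt.differentiableWithinAt)
      (fun y hy => (hder y hy).deriv) hx hhalf

/-- `(1 - x) ₂F₁(a, 1 - a; 1; x)²` is strictly decreasing. -/
lemma strictAntiOn_one_sub_mul_hypF_sq (ha : a ∈ Ioo (0 : ℝ) 1) :
    StrictAntiOn (fun x => (1 - x) * hypF a x ^ 2) (Ioo 0 1) := by
  have hder : ∀ x ∈ Ioo (0 : ℝ) 1, HasDerivAt (fun x => (1 - x) * hypF a x ^ 2)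
      (-hypF a x ^ 2 + 2 * hypF a x * (a * (1 - a) * hypMean a x)) x := by
    intro x hx
    have hx1 : |x| < 1 := by rw [abs_of_pos hx.1]; exact hx.2
    have hs : HasDerivAt (fun y : ℝ => 1 - y) (-1) x := by
      simpa using (hasDerivAt_id x).const_sub 1
    refine (hs.mul ((hasDerivAt_hypF ha hx1).pow 2)).congr_deriv ?_
    have h1 : 1 - x ≠ 0 := (sub_pos.2 hx.2).ne'
    simp only [Nat.cast_ofNat, Nat.add_one_sub_one, pow_one, Pi.pow_apply]
    field_simp
  refine strictAntiOn_of_deriv_neg (convex_Ioo 0 1)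
    (fun x hx => (hder x hx).continuousAt.continuousWithinAt) fun x hx => ?_
  rw [interior_Ioo] at hx
  rw [(hder x hx).deriv]
  have hx' : x ∈ Ico (0 : ℝ) 1 := ⟨hx.1.le, hx.2⟩
  have h1 := hypF_pos ha hx'
  have h2 := hypMean_le_hypF ha hx'
  have h3 := hypMean_pos ha hx'
  -- With G ≤ F, this bounds the derivative above by -F² + F²/2 < 0.
  have h4 : a * (1 - a) ≤ 1 / 4 := by nlinarith [sq_nonneg (a - 1 / 2)]
  have h5 : a * (1 - a) * hypMean a x ≤ 1 / 4 * hypF a x :=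
    mul_le_mul h4 h2 h3.le (by norm_num)
  nlinarith [mul_pos h1 h1]

/-! ### The modulus in the logarithmic variable. -/

lemma complArg_sq {r : ℝ} (hr : r ∈ Ioo (0 : ℝ) 1) : complArg r ^ 2 = 1 - r ^ 2 := by
  rw [complArg, Real.sq_sqrt]
  nlinarith [hr.1, hr.2]

lemma sin_pi_mul_pos (ha : a ∈ Ioo (0 : ℝ) 1) : 0 < Real.sin (Real.pi * a) :=
  Real.sin_pos_of_pos_of_lt_pi (mul_pos Real.pi_pos ha.1)
    (mul_lt_of_lt_one_right Real.pi_pos ha.2)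

lemma genModulus_pos (ha : a ∈ Ioo (0 : ℝ) 1) {r : ℝ} (hr : r ∈ Ioo (0 : ℝ) 1) :
    0 < genModulus a r := by
  have h1 := hypF_pos ha (x := r ^ 2) ⟨by positivity, by nlinarith [hr.1, hr.2]⟩
  have h2 := hypF_pos ha (x := 1 - r ^ 2)
    ⟨by nlinarith [hr.1, hr.2], by linarith [pow_pos hr.1 2]⟩
  have h3 := sin_pi_mul_pos ha
  rw [genModulus, complArg_sq hr]
  have := Real.pi_pos
  positivity

lemma tendsto_genModulus_one (ha : a ∈ Ioo (0 : ℝ) 1) :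
    Tendsto (genModulus a) (𝓝[<] 1) (𝓝 0) := by
  have hsq : Tendsto (fun r : ℝ => r ^ 2) (𝓝[<] 1) (𝓝[<] 1) := by
    refine tendsto_nhdsWithin_iff.2 ⟨?_, ?_⟩
    · have : Tendsto (fun r : ℝ => r ^ 2) (𝓝 1) (𝓝 (1 ^ 2)) := tendsto_id.pow 2
      rw [one_pow] at this
      exact this.mono_left nhdsWithin_le_nhds
    · filter_upwards [Ioo_mem_nhdsLT (zero_lt_one' ℝ)] with r hr
      have := hr.1
      have := hr.2
      simp only [mem_Iio]
      nlinarith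
  have hnum : Tendsto (fun r : ℝ => hypF a (1 - r ^ 2)) (𝓝[<] 1) (𝓝 (hypF a 0)) := by
    have h0 : Tendsto (hypF a) (𝓝 0) (𝓝 (hypF a 0)) :=
      (hasDerivAt_hypF ha (by simp)).continuousAt
    refine h0.comp ?_
    have : Tendsto (fun r : ℝ => 1 - r ^ 2) (𝓝 1) (𝓝 (1 - 1 ^ 2)) :=
      tendsto_const_nhds.sub (tendsto_id.pow 2)
    rw [one_pow, sub_self] at this
    exact this.mono_left nhdsWithin_le_nhds
  have h := (hnum.div_atTop ((tendsto_hypF_atTop ha).comp hsq)).const_mul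
    (Real.pi / (2 * Real.sin (Real.pi * a)))
  rw [mul_zero] at h
  refine h.congr' ?_
  filter_upwards [Ioo_mem_nhdsLT (zero_lt_one' ℝ)] with r hr
  rw [genModulus, complArg_sq hr, Function.comp_apply]

/-- The quotient rule puts the Legendre expression in the numerator, so the derivative depends on x
= e²ᵗ only through (1 - x) F(x)². -/
lemma exists_hasDerivAt_genModulus_exp (ha : a ∈ Ioo (0 : ℝ) 1) : ∃ C : ℝ, 0 < C ∧
    ∀ t ∈ Iio (0 : ℝ), HasDerivAt (fun t => genModulus a (Real.exp t))
      (-(C / ((1 - Real.exp t ^ 2) * hypF a (Real.exp t ^ 2) ^ 2))) t := by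
  obtain ⟨w, hw, hW⟩ := exists_legendre_const ha
  have hsin := sin_pi_mul_pos ha
  have hq : 0 < a * (1 - a) := mul_pos ha.1 (sub_pos.2 ha.2)
  have hpi := Real.pi_pos
  refine ⟨Real.pi / (2 * Real.sin (Real.pi * a)) * (2 * (a * (1 - a) * w)), by positivity,
    fun t ht => ?_⟩
  have hmem : ∀ s ∈ Iio (0 : ℝ), Real.exp s ∈ Ioo (0 : ℝ) 1 := fun s hs =>
    ⟨Real.exp_pos s, Real.exp_lt_one_iff.2 hs⟩
  have hx : Real.exp t ^ 2 ∈ Ioo (0 : ℝ) 1 := by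
    have := hmem t ht
    exact ⟨pow_pos this.1 2, by nlinarith [this.1, this.2]⟩
  have hexp : HasDerivAt (fun s => Real.exp s ^ 2) (2 * Real.exp t ^ 2) t := by
    refine ((Real.hasDerivAt_exp t).pow 2).congr_deriv ?_
    simp only [Nat.cast_ofNat, Nat.add_one_sub_one, pow_one]
    ring
  have hF := hypF_pos ha ⟨hx.1.le, hx.2⟩
  have hWx := hW _ hx
  have hx1 : |Real.exp t ^ 2| < 1 := by rw [abs_of_pos hx.1]; exact hx.2
  have hx2 : |1 - Real.exp t ^ 2| < 1 := by rw [abs_of_pos (sub_pos.2 hx.2)]; linarith [hx.1]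
  have hcompl : HasDerivAt (fun s => 1 - Real.exp s ^ 2) (-(2 * Real.exp t ^ 2)) t :=
    hexp.const_sub 1
  have hnum : HasDerivAt (fun s => hypF a (1 - Real.exp s ^ 2)) _ t :=
    (hasDerivAt_hypF ha hx2).comp t hcompl
  have hden : HasDerivAt (fun s => hypF a (Real.exp s ^ 2)) _ t :=
    (hasDerivAt_hypF ha hx1).comp t hexp
  have h := (hnum.fun_div hden hF.ne').const_mul (Real.pi / (2 * Real.sin (Real.pi * a)))
  refine (h.congr_of_eventuallyEq ?_).congr_deriv ?_
  · filter_upwards [isOpen_Iio.mem_nhds ht] with s hs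
    rw [genModulus, complArg_sq (hmem s hs)]
  · have h0 := hx.1.ne'
    have h1 : 1 - Real.exp t ^ 2 ≠ 0 := (sub_pos.2 hx.2).ne'
    simp only [sub_sub_cancel]
    generalize Real.exp t ^ 2 = x at *
    rw [← hWx]
    have := hF.ne'
    field_simp
    ring

lemma strictAntiOn_genModulus_exp (ha : a ∈ Ioo (0 : ℝ) 1) :
    StrictAntiOn (fun t => genModulus a (Real.exp t)) (Iio 0) := by
  obtain ⟨C, hC, hder⟩ := exists_hasDerivAt_genModulus_exp ha
  refine strictAntiOn_of_deriv_neg (convex_Iio 0)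
    (fun t ht => (hder t ht).continuousAt.continuousWithinAt) fun t ht => ?_
  rw [interior_Iio] at ht
  rw [(hder t ht).deriv, neg_lt_zero]
  have h1 : Real.exp t ^ 2 < 1 := pow_lt_one₀ (Real.exp_pos t).le (Real.exp_lt_one_iff.2 ht) two_ne_zero
  have h2 := hypF_pos ha (x := Real.exp t ^ 2) ⟨by positivity, h1⟩
  have h3 := sub_pos.2 h1
  positivity

/-- `t ↦ μ_a(eᵗ)` is strictly concave on the negative half-line. -/
lemma strictConcaveOn_genModulus_exp (ha : a ∈ Ioo (0 : ℝ) 1) :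
    StrictConcaveOn ℝ (Iio 0) (fun t => genModulus a (Real.exp t)) := by
  obtain ⟨C, hC, hder⟩ := exists_hasDerivAt_genModulus_exp ha
  refine StrictAntiOn.strictConcaveOn_of_deriv (convex_Iio 0)
    (fun t ht => (hder t ht).continuousAt.continuousWithinAt) ?_
  rw [interior_Iio]
  intro s hs t ht hst
  rw [(hder s hs).deriv, (hder t ht).deriv, neg_lt_neg_iff]
  have hmem : ∀ s ∈ Iio (0 : ℝ), Real.exp s ^ 2 ∈ Ioo (0 : ℝ) 1 := fun s hs =>
    ⟨by positivity, pow_lt_one₀ (Real.exp_pos s).le (Real.exp_lt_one_iff.2 hs) two_ne_zero⟩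
  have h := strictAntiOn_one_sub_mul_hypF_sq ha (hmem s hs) (hmem t ht)
    (pow_lt_pow_left₀ (Real.exp_lt_exp.2 hst) (Real.exp_pos s).le two_ne_zero)
  have h1 := sub_pos.2 (hmem t ht).2
  have h2 := hypF_pos ha ⟨(hmem t ht).1.le, (hmem t ht).2⟩
  exact div_lt_div_of_pos_left hC (by positivity) h

lemma continuousOn_genModulus (ha : a ∈ Ioo (0 : ℝ) 1) :
    ContinuousOn (genModulus a) (Ioo 0 1) := by
  obtain ⟨C, -, hder⟩ := exists_hasDerivAt_genModulus_exp ha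
  have h1 : ContinuousOn (fun t => genModulus a (Real.exp t)) (Iio 0) :=
    fun t ht => (hder t ht).continuousAt.continuousWithinAt
  have h2 : ContinuousOn Real.log (Ioo 0 1) :=
    Real.continuousOn_log.mono fun r hr => hr.1.ne'
  refine (h1.comp h2 fun r hr => Real.log_neg hr.1 hr.2).congr fun r hr => ?_
  simp [Real.exp_log hr.1]

/-- As K ≥ 1, only values up to μ_a(r) are needed, so the limit 0 at r = 1 and continuity suffice;
the limit at 0 plays no role. -/
lemma surjOn_genModulus (ha : a ∈ Ioo (0 : ℝ) 1) {r y : ℝ} (hr : r ∈ Ioo (0 : ℝ) 1)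
    (hy : 0 < y) (hyr : y ≤ genModulus a r) : ∃ s ∈ Ioo (0 : ℝ) 1, genModulus a s = y := by
  obtain ⟨u, hu, huy⟩ := (((tendsto_genModulus_one ha).eventually (gt_mem_nhds hy)).and
    (Ioo_mem_nhdsLT hr.2)).exists.imp fun u h => And.intro h.2 h.1
  obtain ⟨s, hs, hsy⟩ := (isPreconnected_Ioo (a := (0 : ℝ)) (b := 1)).intermediate_value
    ⟨hr.1.trans hu.1, hu.2⟩ hr (continuousOn_genModulus ha) ⟨huy.le, hyr⟩
  exact ⟨s, hs, hsy⟩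

lemma genHerschPfluger_spec (ha : a ∈ Ioo (0 : ℝ) 1) {K : ℝ} (hK : 1 ≤ K) {r : ℝ}
    (hr : r ∈ Ioo (0 : ℝ) 1) : genHerschPfluger K a r ∈ Ioo (0 : ℝ) 1 ∧
      genModulus a (genHerschPfluger K a r) = genModulus a r / K := by
  have hμ := genModulus_pos ha hr
  have h := surjOn_genModulus ha hr (div_pos hμ (by linarith)) (div_le_self hμ.le hK)
  exact ⟨Function.invFunOn_mem h, Function.invFunOn_eq h⟩

end Parameters

theorem lemma3 (a : ℝ) (ha : a ∈ Set.Ioc (0 : ℝ) (1 / 2)) (K : ℝ) (hK : 1 < K) :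
    StrictAntiOn (fun r : ℝ => normalizedDistortion K a r) (Set.Ioo 0 1) := by
  have ha' : a ∈ Ioo (0 : ℝ) 1 := ⟨ha.1, ha.2.trans_lt (by norm_num)⟩
  have hanti := strictAntiOn_genModulus_exp ha'
  have hconc := strictConcaveOn_genModulus_exp ha'
  intro r₁ hr₁ r₂ hr₂ hr
  have hK0 : 0 < K := by linarith
  obtain ⟨hs₁, e₁⟩ := genHerschPfluger_spec ha' hK.le hr₁
  obtain ⟨hs₂, e₂⟩ := genHerschPfluger_spec ha' hK.le hr₂
  simp only [normalizedDistortion]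
  set s₁ := genHerschPfluger K a r₁
  set s₂ := genHerschPfluger K a r₂
  set M : ℝ → ℝ := fun t => genModulus a (Real.exp t) with hM
  have hMlog : ∀ r ∈ Ioo (0 : ℝ) 1, M (Real.log r) = genModulus a r := fun r hr => by
    simp [hM, Real.exp_log hr.1]
  have hlog : ∀ r ∈ Ioo (0 : ℝ) 1, Real.log r ∈ Iio (0 : ℝ) := fun r hr =>
    Real.log_neg hr.1 hr.2
  rw [← hMlog _ hs₁, ← hMlog _ hr₁] at e₁
  rw [← hMlog _ hs₂, ← hMlog _ hr₂] at e₂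
  have p₁ : 0 < M (Real.log r₁) := by rw [hMlog _ hr₁]; exact genModulus_pos ha' hr₁
  have p₂ : 0 < M (Real.log r₂) := by rw [hMlog _ hr₂]; exact genModulus_pos ha' hr₂
  have x₁ := hlog _ hr₁
  have x₂ := hlog _ hr₂
  have y₁ := hlog _ hs₁
  have y₂ := hlog _ hs₂
  have hxx : Real.log r₁ < Real.log r₂ := Real.log_lt_log hr₁.1 hr
  have key : Real.log s₂ - Real.log s₁ < (Real.log r₂ - Real.log r₁) / K := by
    generalize Real.log r₁ = u₁ at *
    generalize Real.log r₂ = u₂ at *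
    generalize Real.log s₁ = v₁ at *
    generalize Real.log s₂ = v₂ at *
    have huv₁ : u₁ < v₁ := (hanti.lt_iff_gt y₁ x₁).1 (by rw [e₁]; exact div_lt_self p₁ hK)
    have huv₂ : u₂ < v₂ := (hanti.lt_iff_gt y₂ x₂).1 (by rw [e₂]; exact div_lt_self p₂ hK)
    have hMu : M u₂ < M u₁ := hanti x₁ x₂ hxx
    have hvv : v₁ < v₂ := (hanti.lt_iff_gt y₂ y₁).1 (by
      rw [e₁, e₂]; exact div_lt_div_of_pos_right hMu hK0)
    -- The chord over [u₁, v₂] is intermediate: slope[v₁, v₂] < slope[u₁, v₂] < slope[u₁, u₂].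
    have k₁ := hconc.secant_strict_mono x₁ x₂ y₂ hxx.ne' (hxx.trans huv₂).ne' huv₂
    have k₂ := hconc.secant_strict_mono y₂ x₁ y₁ (hxx.trans huv₂).ne hvv.ne huv₁
    rw [← neg_div_neg_eq, neg_sub, neg_sub, ← neg_div_neg_eq (M u₁ - M v₂), neg_sub, neg_sub]
      at k₂
    have k := k₂.trans k₁
    change (M v₂ - M v₁) / (v₂ - v₁) < (M u₂ - M u₁) / (u₂ - u₁) at k
    rw [e₁, e₂, div_lt_div_iff₀ (sub_pos.2 hvv) (sub_pos.2 hxx), ← sub_div] at k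
    rw [lt_div_iff₀ hK0]
    have k3 : (M u₁ - M u₂) * ((v₂ - v₁) * K) < (M u₁ - M u₂) * (u₂ - u₁) := by
      have := mul_lt_mul_of_pos_right k hK0
      field_simp at this
      linarith
    exact lt_of_mul_lt_mul_left k3 (sub_pos.2 hMu).le
  have l₁ : 0 < r₁ ^ (-(1 / K)) := Real.rpow_pos_of_pos hr₁.1 _
  have l₂ : 0 < r₂ ^ (-(1 / K)) := Real.rpow_pos_of_pos hr₂.1 _
  rw [← Real.log_lt_log_iff (mul_pos hs₂.1 l₂) (mul_pos hs₁.1 l₁),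
    Real.log_mul hs₂.1.ne' l₂.ne', Real.log_mul hs₁.1.ne' l₁.ne', Real.log_rpow hr₁.1,
    Real.log_rpow hr₂.1]
  have : (Real.log r₂ - Real.log r₁) / K = 1 / K * Real.log r₂ - 1 / K * Real.log r₁ := by ring
  linarith
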